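/- **Definitions.** Let $V$ be a non-empty finite set. A weight function on $V^2$ is a map $w:V\times V\to\mathbb R$ with $w(u,v)=w(v,u)\ge 0$ and $w(v,v)=0$ for all $u,v$; it is $b$-bounded if $w(u,v)\le b$ for all $u,v$. Let $G_w$ be the graph on $V$ in which $u,v$ are adjacent when $w(u,v)>0$. Put $\deg_w(u)=\sum_v w(u,v)$, $\mathrm{vol}_w(X)=\sum_{u\in X}\deg_w(u)$, and $w(V)=e_w(V)=\frac12\sum_{u,v\in V}w(u,v)$. For a partition $\mathcal A$ of $V$ let $$q_{\mathcal A}(w)=\frac1{\mathrm{vol}_w(V)}\sum_{A\in\mathcal A}\ \sum_{u,v\in A}\Big(w(u,v)-\frac{\deg_w(u)\deg_w(v)}{\mathrm{vol}_w(V)}\Big)$$ ($q_{\mathcal A}(w)=0$ if $w$ is identically $0$), let $q^*(w)=\max_{\mathcal A}q_{\mathcal A}(w)$ and $\delta_{\mathcal A}(w)=q^*(w)-q_{\mathcal A}(w)$. For $0<p\le1$, $w_p$ is the random weight function obtained by considering each edge $uv$ of $G_w$ independently, keeping $w(u,v)$ with probability $p$ and otherwise setting it to $0$. **Theorem.** There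 is an algorithm (a program of a random access machine whose unit-cost steps are arithmetic operations and comparisons on real numbers, together with additions, subtractions and comparisons of indices and indirect addressing) and a constant $K$ with the following property. The algorithm takes as input a number $\varepsilon>0$, a weight function on $V^2$ given by the list of its edges (the pairs of positive weight) with their weights, and a partition of $V$ given by vertex labels. On every such input it outputs a partition of $V$ after at most $K\,(|V|+m)$ steps, where $m$ is the number of listed edges. Moreover, for each $b>0$ and $\varepsilon>0$ there exists $c=c(b,\varepsilon)>0$ such that for every non-empty finite set $V$, every $0<p\le1$ and every $b$-bounded weight function $w$ on $V^2$ with $w(V)\,p\ge c\,|V|$, with probability at least $1-\varepsilon$ both of the following hold: (a) $|q^*(w_p)-q^*(w)|<\varepsilon$; (b) for every partition $\mathcal A$ of $V$, the algorithm, given $\varepsilon$, $w_p$ and $\mathcal A$ (and not $w$ or $p$), outputs a partition $\mathcal A'$ with $\delta_{\mathcal A'}(w)<\delta_{\mathcal A}(w_p)+\varepsilon$. -/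

import Mathlib

open Finset
open scoped unitInterval ProbabilityTheory

universe u

noncomputable section

/-! ### Weight functions and their modularity -/

/-- A weight function on `V²`: symmetric, nonnegative, and zero on the diagonal. -/
structure WeightFunction (V : Type u) where
  weight : V → V → ℝ
  symm : ∀ x y, weight x y = weight y x
  nonneg : ∀ x y, 0 ≤ weight x y
  diag : ∀ x, weight x x = 0

namespace WeightFunction

variable {V : Type u}

/-- `w` is `b`-bounded if every weight is at most `b`. -/
def Bounded (w : WeightFunction V) (b : ℝ) : Prop := ∀ x y, w.weight x y ≤ b

/-- The graph `G_w`: distinct vertices `x`, `y` are adjacent when `w(x,y) > 0`. -/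
def graph (w : WeightFunction V) : SimpleGraph V where
  Adj x y := 0 < w.weight x y
  symm := ⟨fun x y h => by rw [w.symm y x]; exact h⟩
  loopless := ⟨fun x h => by rw [w.diag x] at h; exact lt_irrefl _ h⟩

open Classical in
/-- The weight function that keeps the weights of the pairs in `S` and sets all others to `0`. -/
def keep (w : WeightFunction V) (S : Set (Sym2 V)) : WeightFunction V where
  weight x y := if s(x, y) ∈ S then w.weight x y else 0
  symm x y := by rw [Sym2.eq_swap, w.symm x y]
  nonneg x y := by split_ifs; exacts [w.nonneg x y, le_rfl]
  diag x := by rw [w.diag x, ite_self]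

/-- The law of the random set of edges of `G_w` in which each edge is kept independently with
probability `p`. If `S` is distributed in this way, then `w.keep S` is the random weight
function `w_p`. -/
def edgeLaw (w : WeightFunction V) (p : I) : MeasureTheory.Measure (Set (Sym2 V)) :=
  setBer(w.graph.edgeSet, p)

variable [Fintype V]

/-- The weighted degree `∑_y w(x,y)`. -/
def deg (w : WeightFunction V) (x : V) : ℝ := ∑ y, w.weight x y

/-- The weighted volume of a set of vertices. -/
def vol (w : WeightFunction V) (X : Finset V) : ℝ := ∑ x ∈ X, w.deg x

/-- The total weight `e_w(X) = ½ ∑_{x,y ∈ X} w(x,y)` of the edges inside `X`. -/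
def edgeWeight (w : WeightFunction V) (X : Finset V) : ℝ :=
  (1 / 2) * ∑ x ∈ X, ∑ y ∈ X, w.weight x y

variable [DecidableEq V]

/-- The modularity score of a vertex partition. For the zero weight function the volume of the
vertex set is `0`, and the value is `0` by the convention `1 / 0 = 0`. -/
def score (w : WeightFunction V) (A : Finpartition (univ : Finset V)) : ℝ :=
  (1 / w.vol univ) * ∑ X ∈ A.parts, ∑ x ∈ X, ∑ y ∈ X,
    (w.weight x y - w.deg x * w.deg y / w.vol univ)

/-- The modularity of `w`: the maximum of the scores over the (finitely many) partitions. -/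
def modularity (w : WeightFunction V) : ℝ :=
  (univ : Finset (Finpartition (univ : Finset V))).sup' ⟨⊥, mem_univ _⟩ w.score

/-- The modularity deficit of a partition. -/
def deficit (w : WeightFunction V) (A : Finpartition (univ : Finset V)) : ℝ :=
  w.modularity - w.score A

end WeightFunction

/-! ### A random access machine over the reals, with a step count

Programs are while-programs over finitely many registers and arrays, some holding natural numbers
(used as indices and counters) and some holding real numbers. Every instruction and every test
costs one step. -/

/-- The memory: registers and (indirectly addressed) arrays, over `ℕ` and over `ℝ`. -/
structure Store where
  nreg : ℕ → ℕ
  narr : ℕ → ℕ → ℕ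
  rreg : ℕ → ℝ
  rarr : ℕ → ℕ → ℝ

/-- The instructions. Natural-number registers admit constants, addition and truncated
subtraction; real registers admit natural constants and the four arithmetic operations (with
`r / 0 = 0`). Arrays are read and written at an index held in a natural-number register. -/
inductive Instr
  /-- `nreg x := k` -/
  | nconst (x k : ℕ)
  /-- `nreg x := nreg y + nreg z` -/
  | nadd (x y z : ℕ)
  /-- `nreg x := nreg y - nreg z` -/
  | nsub (x y z : ℕ)
  /-- `nreg x := narr a (nreg i)` -/
  | nload (x a i : ℕ)
  /-- `narr a (nreg i) := nreg x` -/
  | nstore (a i x : ℕ)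
  /-- `rreg x := k` -/
  | rconst (x k : ℕ)
  /-- `rreg x := rreg y + rreg z` -/
  | radd (x y z : ℕ)
  /-- `rreg x := rreg y - rreg z` -/
  | rsub (x y z : ℕ)
  /-- `rreg x := rreg y * rreg z` -/
  | rmul (x y z : ℕ)
  /-- `rreg x := rreg y / rreg z` -/
  | rdiv (x y z : ℕ)
  /-- `rreg x := rarr a (nreg i)` -/
  | rload (x a i : ℕ)
  /-- `rarr a (nreg i) := rreg x` -/
  | rstore (a i x : ℕ)

open Function in
/-- The effect of an instruction on the memory. -/
def Instr.exec : Instr → Store → Store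
  | nconst x k, s => { s with nreg := update s.nreg x k }
  | nadd x y z, s => { s with nreg := update s.nreg x (s.nreg y + s.nreg z) }
  | nsub x y z, s => { s with nreg := update s.nreg x (s.nreg y - s.nreg z) }
  | nload x a i, s => { s with nreg := update s.nreg x (s.narr a (s.nreg i)) }
  | nstore a i x, s =>
      { s with narr := update s.narr a (update (s.narr a) (s.nreg i) (s.nreg x)) }
  | rconst x k, s => { s with rreg := update s.rreg x (k : ℝ) }
  | radd x y z, s => { s with rreg := update s.rreg x (s.rreg y + s.rreg z) }
  | rsub x y z, s => { s with rreg := update s.rreg x (s.rreg y - s.rreg z) }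
  | rmul x y z, s => { s with rreg := update s.rreg x (s.rreg y * s.rreg z) }
  | rdiv x y z, s => { s with rreg := update s.rreg x (s.rreg y / s.rreg z) }
  | rload x a i, s => { s with rreg := update s.rreg x (s.rarr a (s.nreg i)) }
  | rstore a i x, s =>
      { s with rarr := update s.rarr a (update (s.rarr a) (s.nreg i) (s.rreg x)) }

/-- The tests: comparison of two natural-number registers or of two real registers. -/
inductive Test
  /-- `nreg x < nreg y` -/
  | nlt (x y : ℕ)
  /-- `rreg x ≤ rreg y` -/
  | rle (x y : ℕ)

/-- The truth value of a test. -/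
def Test.Holds : Test → Store → Prop
  | nlt x y, s => s.nreg x < s.nreg y
  | rle x y, s => s.rreg x ≤ s.rreg y

/-- While-programs. -/
inductive Program
  | skip
  | instr (i : Instr)
  | seq (P Q : Program)
  | cond (b : Test) (P Q : Program)
  | loop (b : Test) (P : Program)

/-- `P.Runs s t s'`: started in memory `s`, the program `P` halts after exactly `t` steps with
memory `s'`. -/
inductive Program.Runs : Program → Store → ℕ → Store → Prop
  | skip (s : Store) : Runs .skip s 1 s
  | instr (i : Instr) (s : Store) : Runs (.instr i) s 1 (i.exec s)
  | seq {P Q : Program} {s s₁ s₂ : Store} {t₁ t₂ : ℕ} :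
      Runs P s t₁ s₁ → Runs Q s₁ t₂ s₂ → Runs (.seq P Q) s (t₁ + t₂) s₂
  | cond_true {b : Test} {P Q : Program} {s s₁ : Store} {t : ℕ} :
      b.Holds s → Runs P s t s₁ → Runs (.cond b P Q) s (t + 1) s₁
  | cond_false {b : Test} {P Q : Program} {s s₁ : Store} {t : ℕ} :
      ¬ b.Holds s → Runs Q s t s₁ → Runs (.cond b P Q) s (t + 1) s₁
  | loop_true {b : Test} {P : Program} {s s₁ s₂ : Store} {t₁ t₂ : ℕ} :
      b.Holds s → Runs P s t₁ s₁ → Runs (.loop b P) s₁ t₂ s₂ →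
        Runs (.loop b P) s (t₁ + t₂ + 1) s₂
  | loop_false {b : Test} {P : Program} {s : Store} :
      ¬ b.Holds s → Runs (.loop b P) s 1 s

/-- The semantics is deterministic: final memory and number of steps are determined by the
program and the initial memory. -/
theorem Program.Runs.deterministic {P : Program} {s s₁ : Store} {t₁ : ℕ}
    (h₁ : P.Runs s t₁ s₁) : ∀ {t₂ : ℕ} {s₂ : Store}, P.Runs s t₂ s₂ → t₁ = t₂ ∧ s₁ = s₂ := by
  induction h₁ with
  | skip s => intro _ _ h; cases h; exact ⟨rfl, rfl⟩
  | instr i s => intro _ _ h; cases h; exact ⟨rfl, rfl⟩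
  | seq _ _ ih ih' =>
    intro _ _ h
    cases h with
    | seq h h' =>
      obtain ⟨rfl, rfl⟩ := ih h
      obtain ⟨rfl, rfl⟩ := ih' h'
      exact ⟨rfl, rfl⟩
  | cond_true hb _ ih =>
    intro _ _ h
    cases h with
    | cond_true _ h => obtain ⟨rfl, rfl⟩ := ih h; exact ⟨rfl, rfl⟩
    | cond_false hb' _ => exact absurd hb hb'
  | cond_false hb _ ih =>
    intro _ _ h
    cases h with
    | cond_true hb' _ => exact absurd hb' hb
    | cond_false _ h => obtain ⟨rfl, rfl⟩ := ih h; exact ⟨rfl, rfl⟩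
  | loop_true hb _ _ ih ih' =>
    intro _ _ h
    cases h with
    | loop_true _ h h' =>
      obtain ⟨rfl, rfl⟩ := ih h
      obtain ⟨rfl, rfl⟩ := ih' h'
      exact ⟨rfl, rfl⟩
    | loop_false hb' => exact absurd hb hb'
  | loop_false hb =>
    intro _ _ h
    cases h with
    | loop_true hb' _ _ => exact absurd hb' hb
    | loop_false _ => exact ⟨rfl, rfl⟩

/-! ### Weighted graphs and partitions as inputs and outputs -/

section Encoding

variable {V : Type u} [Fintype V] [DecidableEq V]

/-- A labelling of the vertices by `0, …, |V| - 1` describes a partition if two vertices have the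
same label exactly when they lie in the same part. -/
def Describes (label : V → Fin (Fintype.card V)) (A : Finpartition (univ : Finset V)) : Prop :=
  ∀ x y, label x = label y ↔ A.part x = A.part y

/-- An input instance: a numbering of the vertices, a list containing every edge of `G_w` exactly
once (in some order, each with some orientation), and a labelling of the vertices describing the
partition `A`. -/
structure Encoding (w : WeightFunction V) (A : Finpartition (univ : Finset V)) where
  enum : V ≃ Fin (Fintype.card V)
  edges : List (V × V)
  edges_nodup : (edges.map fun q => s(q.1, q.2)).Nodup
  mem_edges : ∀ e : Sym2 V, e ∈ (edges.map fun q => s(q.1, q.2)) ↔ e ∈ w.graph.edgeSet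
  label : V → Fin (Fintype.card V)
  describes : Describes label A

namespace Encoding

variable {w : WeightFunction V} {A : Finpartition (univ : Finset V)}

/-- The size of an instance: number of vertices plus number of edges. -/
def size (E : Encoding w A) : ℕ := Fintype.card V + E.edges.length

/-- The initial memory for an instance and a parameter `ε`. The natural-number registers `0`, `1`
hold the numbers of vertices and edges, the real register `0` holds `ε`. The `i`-th listed edge
has its ends in position `i` of the natural-number arrays `0`, `1` and its weight in position `i`
of the real array `0`. The label of the `i`-th vertex is in position `i` of the natural-number
array `2`. Everything else is `0`. -/
def store (E : Encoding w A) (ε : ℝ) : Store where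
  nreg
    | 0 => Fintype.card V
    | 1 => E.edges.length
    | _ => 0
  narr
    | 0 => fun i => (E.edges[i]?).elim 0 fun q => (E.enum q.1 : ℕ)
    | 1 => fun i => (E.edges[i]?).elim 0 fun q => (E.enum q.2 : ℕ)
    | 2 => fun i => if h : i < Fintype.card V then (E.label (E.enum.symm ⟨i, h⟩) : ℕ) else 0
    | _ => fun _ => 0
  rreg
    | 0 => ε
    | _ => 0
  rarr
    | 0 => fun i => (E.edges[i]?).elim 0 fun q => w.weight q.1 q.2
    | _ => fun _ => 0

end Encoding

/-- On the instance `E` with parameter `ε`, the program `P` halts after at most `T` steps, and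
then the natural-number array `3` holds a labelling that describes the partition `A'`. -/
def Program.Outputs (P : Program) {w : WeightFunction V} {A : Finpartition (univ : Finset V)}
    (E : Encoding w A) (ε : ℝ) (T : ℕ) (A' : Finpartition (univ : Finset V)) : Prop :=
  ∃ (t : ℕ) (s : Store) (label : V → Fin (Fintype.card V)),
    P.Runs (E.store ε) t s ∧ t ≤ T ∧
      (∀ x, s.narr 3 (E.enum x) = label x) ∧ Describes label A'

end Encoding

end

/-! Two facts carry the proof: a partition can be coarsened to boundedly many classes at little cost
in modularity, and on partitions into boundedly many classes the scores under `w` and `w_p` nearly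
agree.

Coarsening. Merging classes can only gain edge weight, since weights are nonnegative; it loses only
the degree products between merged classes. Next-fit packing of the classes by volume, closing a bin
once it holds an `η` fraction of the total, uses at most `1/η + 1` bins. A class joins a bin holding
at most `η * vol`, so the loss is at most `2η` (`nextFit.sum_mul_le`, `labelScore_mergeLabel`),
however large single classes are. The rule needs only class volumes, so it runs in linear time
knowing neither `w` nor `p`; it is the algorithm.

Sampling. For fixed `X` the kept weight inside `X` is a sum of independent terms bounded by `b`, and
a Chernoff bound gives failure probability exponentially small in `w(V) p`. Since `w(V) p ≥ c |V|`,
this survives a union bound over all `2^|V|` sets `X` (`edgeLaw_close`). On the resulting event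
`Close`, everything is deterministic: a score with `k` labels is a sum of `k` terms built from
weights inside sets, so it moves by at most `6kδ` (`Close.abs_labelScore_sub_le`). Uniformity in `X`
lets the input partition depend on the sample.

For (a), coarsen an optimal partition of either weight function and evaluate it under the other
(`modularity_sub_le`). For (b), coarsen the given partition under `w_p`, then transfer its score to
`w`. -/

noncomputable section

/-! ### Chernoff bound for weighted Bernoulli sums -/

open MeasureTheory in
/-- The exponential moment of a weighted sum of independent centred Bernoulli variables. -/
theorem integral_exp_setBernoulli_le {ι : Type*} [Fintype ι] [DecidableEq ι] (u : Set ι) (p : I)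
    (a : ι → ℝ) (ha : ∀ i, |a i| ≤ 1) (hu : ∀ i, i ∉ u → a i = 0) :
    ∫ S, Real.exp (∑ i, (S.indicator 1 i - (p : ℝ)) * a i) ∂setBer(u, p)
      ≤ Real.exp ((p : ℝ) * ∑ i, a i ^ 2) := by
  classical
  rw [ProbabilityTheory.setBernoulli_eq_map, integral_map (by fun_prop) (by fun_prop),
    Measure.infinitePi_eq_pi]
  -- The integrand factors over the coordinates of the product space of propositions, so the
  -- integral becomes a product of two-point averages.
  have h1 : ∀ P : ι → Prop, Real.exp (∑ i, (Set.indicator {i | P i} 1 i - (p : ℝ)) * a i)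
      = ∏ i, (fun i (q : Prop) => Real.exp (((if q then 1 else 0) - (p : ℝ)) * a i)) i (P i) := by
    intro P
    rw [Real.exp_sum]
    simp [Set.indicator_apply]
  simp_rw [h1]
  rw [integral_fintype_prod_eq_prod
    (fun i (q : Prop) => Real.exp (((if q then 1 else 0) - (p : ℝ)) * a i)), Finset.mul_sum,
    Real.exp_sum]
  refine Finset.prod_le_prod (fun i _ => integral_nonneg fun _ => (Real.exp_pos _).le) ?_
  intro i _
  have hp0 : (0 : ℝ) ≤ p := p.2.1
  have hp1 : (p : ℝ) ≤ 1 := p.2.2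
  rw [integral_add_measure (.of_finite) (.of_finite), integral_smul_nnreal_measure,
    integral_smul_nnreal_measure, integral_dirac, integral_dirac]
  by_cases hi : i ∈ u
  -- The two inequalities are `e^a ≤ 1 + a + a²` for `|a| ≤ 1`, then `1 + x ≤ e^x` at `x = p(a +
  -- a²)`; centring cancels the linear term.
  · have h2 : Real.exp (a i) ≤ 1 + a i + a i ^ 2 := by
      have := abs_le.1 (Real.abs_exp_sub_one_sub_id_le (ha i))
      linarith
    have h3 : (p : ℝ) * Real.exp (a i) + (1 - p) ≤ Real.exp (p * (a i + a i ^ 2)) := by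
      have := Real.add_one_le_exp ((p : ℝ) * (a i + a i ^ 2))
      nlinarith
    have h4 : Real.exp (-(p * a i)) * (p * Real.exp (a i) + (1 - p)) ≤
        Real.exp (-(p * a i)) * Real.exp (p * (a i + a i ^ 2)) :=
      mul_le_mul_of_nonneg_left h3 (Real.exp_pos _).le
    rw [← Real.exp_add, mul_add, mul_left_comm, ← Real.exp_add] at h4
    simp only [hi, if_true, if_false, NNReal.smul_def, unitInterval.coe_toNNReal, smul_eq_mul,
      unitInterval.coe_symm_eq]
    rw [show (1 - (p : ℝ)) * a i = -(p * a i) + a i by ring,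
      show (0 - (p : ℝ)) * a i = -(p * a i) by ring,
      show (p : ℝ) * a i ^ 2 = -(p * a i) + p * (a i + a i ^ 2) by ring]
    linarith
  · simp [hi, hu i hi, NNReal.smul_def]

-- Markov's inequality for the exponential. The usual free parameter is absorbed into the
-- coefficients `a`.
open MeasureTheory in
theorem setBernoulli_tail_le {ι : Type*} [Fintype ι] [DecidableEq ι] (u : Set ι) (p : I)
    (a : ι → ℝ) (ha : ∀ i, |a i| ≤ 1) (hu : ∀ i, i ∉ u → a i = 0) (r : ℝ) :
    setBer(u, p).real {S | r ≤ ∑ i, (S.indicator 1 i - (p : ℝ)) * a i}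
      ≤ Real.exp ((p : ℝ) * ∑ i, a i ^ 2 - r) := by
  have h := mul_meas_ge_le_integral_of_nonneg (μ := setBer(u, p))
    (f := fun S => Real.exp (∑ i, (S.indicator 1 i - (p : ℝ)) * a i))
    (.of_forall fun _ => (Real.exp_pos _).le) (.of_finite) (Real.exp r)
  simp only [Real.exp_le_exp] at h
  rw [Real.exp_sub, le_div_iff₀ (Real.exp_pos _), mul_comm]
  exact h.trans (integral_exp_setBernoulli_le u p a ha hu)

/-! ### Concentration of the weights inside vertex sets -/

namespace WeightFunction

variable {V : Type u} [Fintype V]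

theorem edgeWeight_le_univ (w : WeightFunction V) (X : Finset V) :
    w.edgeWeight X ≤ w.edgeWeight univ := by
  unfold edgeWeight
  refine mul_le_mul_of_nonneg_left ?_ (by norm_num)
  calc _ ≤ ∑ x ∈ X, ∑ y, w.weight x y := Finset.sum_le_sum fun x _ =>
        Finset.sum_le_sum_of_subset_of_nonneg (subset_univ _) fun y _ _ => w.nonneg x y
    _ ≤ _ := Finset.sum_le_sum_of_subset_of_nonneg (subset_univ _) fun x _ _ =>
        Finset.sum_nonneg fun y _ => w.nonneg x y

omit [Fintype V] in
theorem edgeWeight_nonneg (w : WeightFunction V) (X : Finset V) : 0 ≤ w.edgeWeight X :=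
  mul_nonneg (by norm_num) (Finset.sum_nonneg fun x _ => Finset.sum_nonneg fun y _ => w.nonneg x y)

theorem deg_nonneg (w : WeightFunction V) (x : V) : 0 ≤ w.deg x :=
  Finset.sum_nonneg fun y _ => w.nonneg x y

theorem vol_univ (w : WeightFunction V) : w.vol univ = 2 * w.edgeWeight univ := by
  simp [vol, edgeWeight, deg]

theorem vol_nonneg (w : WeightFunction V) (X : Finset V) : 0 ≤ w.vol X :=
  Finset.sum_nonneg fun x _ => w.deg_nonneg x

variable [DecidableEq V]

/-- The contribution of the pair `e` to the total weight inside `X`. -/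
def pairWeight (w : WeightFunction V) (X : Finset V) (e : Sym2 V) : ℝ :=
  (1 / 2) * ∑ q ∈ X ×ˢ X with s(q.1, q.2) = e, w.weight q.1 q.2

theorem sum_pairWeight (w : WeightFunction V) (X : Finset V) :
    ∑ e, w.pairWeight X e = w.edgeWeight X := by
  unfold pairWeight edgeWeight
  rw [← Finset.mul_sum, Finset.sum_fiberwise, Finset.sum_product]

/-- This makes the sampled weight linear in the indicators of the kept pairs, the form the Chernoff
bound needs. -/
theorem sum_keep_pairWeight (w : WeightFunction V) (X : Finset V) (S : Set (Sym2 V)) :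
    ∑ e, S.indicator 1 e * w.pairWeight X e = (w.keep S).edgeWeight X := by
  classical
  rw [← sum_pairWeight]
  refine Finset.sum_congr rfl fun e _ => ?_
  unfold pairWeight
  rw [mul_left_comm, Finset.mul_sum]
  congr 1
  refine Finset.sum_congr rfl fun q hq => ?_
  rw [← (Finset.mem_filter.1 hq).2]
  simp [keep, Set.indicator_apply]

omit [Fintype V] in
theorem pairWeight_nonneg (w : WeightFunction V) (X : Finset V) (e : Sym2 V) :
    0 ≤ w.pairWeight X e :=
  mul_nonneg (by norm_num) (Finset.sum_nonneg fun q _ => w.nonneg _ _)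

omit [Fintype V] in
theorem pairWeight_eq_zero (w : WeightFunction V) (X : Finset V) {e : Sym2 V}
    (he : e ∉ w.graph.edgeSet) : w.pairWeight X e = 0 := by
  unfold pairWeight
  rw [Finset.sum_eq_zero, mul_zero]
  intro q hq
  rw [← (Finset.mem_filter.1 hq).2, SimpleGraph.mem_edgeSet] at he
  exact le_antisymm (not_lt.1 he) (w.nonneg _ _)

omit [Fintype V] in
theorem pairWeight_le (w : WeightFunction V) {b : ℝ} (hw : w.Bounded b) (hb : 0 ≤ b)
    (X : Finset V) (e : Sym2 V) : w.pairWeight X e ≤ b := by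
  induction e with
  | _ x y =>
    have h : ((X ×ˢ X).filter fun q => s(q.1, q.2) = s(x, y)) ⊆ {(x, y), (y, x)} := by
      intro q hq
      have := (Finset.mem_filter.1 hq).2
      rw [Sym2.eq_iff] at this
      simpa [Prod.ext_iff] using this
    have h2 : ∑ q ∈ X ×ˢ X with s(q.1, q.2) = s(x, y), w.weight q.1 q.2 ≤ 2 * b := by
      refine (Finset.sum_le_card_nsmul _ _ b fun q _ => hw _ _).trans ?_
      rw [nsmul_eq_mul]
      refine mul_le_mul_of_nonneg_right ?_ hb
      exact_mod_cast (Finset.card_le_card h).trans Finset.card_le_two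
    unfold pairWeight
    linarith

/-- `w'` is uniformly close to `q` times `w`, relative to the total weight. -/
def Close (w w' : WeightFunction V) (q δ : ℝ) : Prop :=
  ∀ X : Finset V, |w'.edgeWeight X - q * w.edgeWeight X| ≤ δ * (q * w.edgeWeight univ)

end WeightFunction

namespace WeightFunction

variable {V : Type u} [Fintype V] [DecidableEq V]

/-- One factor of each square is bounded by `b`. The variance proxy is thus linear in the total
weight, which makes the tail exponent linear in `w(V) p`. -/
theorem sum_sq_pairWeight_le (w : WeightFunction V) {b : ℝ} (hw : w.Bounded b) (hb : 0 ≤ b)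
    (X : Finset V) : ∑ e, w.pairWeight X e ^ 2 ≤ b * w.edgeWeight univ :=
  calc _ ≤ ∑ e, b * w.pairWeight X e := Finset.sum_le_sum fun e _ => by
        rw [sq]
        exact mul_le_mul_of_nonneg_right (w.pairWeight_le hw hb X e) (w.pairWeight_nonneg X e)
    _ = b * w.edgeWeight X := by rw [← Finset.mul_sum, sum_pairWeight]
    _ ≤ _ := mul_le_mul_of_nonneg_left (w.edgeWeight_le_univ X) hb

theorem sum_centred_pairWeight (w : WeightFunction V) (p : I) (X : Finset V) (t : ℝ)
    (S : Set (Sym2 V)) :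
    ∑ e, (S.indicator 1 e - (p : ℝ)) * (t * w.pairWeight X e)
      = t * ((w.keep S).edgeWeight X - p * w.edgeWeight X) := by
  rw [← sum_keep_pairWeight, ← sum_pairWeight, Finset.mul_sum, ← Finset.sum_sub_distrib,
    Finset.mul_sum]
  exact Finset.sum_congr rfl fun e _ => by ring

/-- One-sided concentration of the weight inside `X`; the sign of `t` selects the side. -/
theorem edgeLaw_tail_le (w : WeightFunction V) (p : I) {b δ t : ℝ} (hw : w.Bounded b)
    (hb : 0 < b) (hδ : 0 < δ) (hδ2 : δ ≤ 2) (ht : |t| = δ / (2 * b)) (X : Finset V) :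
    (w.edgeLaw p).real {S | |t| * (δ * (p * w.edgeWeight univ)) ≤
        t * ((w.keep S).edgeWeight X - p * w.edgeWeight X)}
      ≤ Real.exp (-(δ ^ 2 / (4 * b) * (w.edgeWeight univ * p))) := by
  simp_rw [← sum_centred_pairWeight]
  refine (setBernoulli_tail_le w.graph.edgeSet p (fun e => t * w.pairWeight X e) ?_ ?_ _).trans ?_
  · intro e
    rw [abs_mul, ht, abs_of_nonneg (w.pairWeight_nonneg X e)]
    calc _ ≤ δ / (2 * b) * b :=
          mul_le_mul_of_nonneg_left (w.pairWeight_le hw hb.le X e) (by positivity)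
      _ = δ / 2 := by field_simp
      _ ≤ 1 := by linarith
  · intro e he
    rw [w.pairWeight_eq_zero X he, mul_zero]
  · rw [Real.exp_le_exp]
    simp_rw [mul_pow]
    rw [← Finset.mul_sum, ← sq_abs t, ht]
    have h1 := mul_le_mul_of_nonneg_left (w.sum_sq_pairWeight_le hw hb.le X)
      (show 0 ≤ (p : ℝ) * (δ / (2 * b)) ^ 2 from mul_nonneg p.2.1 (sq_nonneg _))
    -- The choice `|t| = δ/(2b)` minimises `t² b - tδ`, with value `-δ²/(4b)`.
    have h2 : (p : ℝ) * (δ / (2 * b)) ^ 2 * (b * w.edgeWeight univ)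
        - δ / (2 * b) * (δ * (p * w.edgeWeight univ))
        = -(δ ^ 2 / (4 * b) * (w.edgeWeight univ * p)) := by
      field_simp
      ring
    linarith

/-- With high probability all the weights inside sets of vertices are close to their means. -/
theorem edgeLaw_close (w : WeightFunction V) (p : I) {b δ : ℝ} (hw : w.Bounded b)
    (hb : 0 < b) (hδ : 0 < δ) (hδ2 : δ ≤ 2) :
    1 - 2 ^ Fintype.card V * (2 * Real.exp (-(δ ^ 2 / (4 * b) * (w.edgeWeight univ * p))))
      ≤ (w.edgeLaw p).real {S | w.Close (w.keep S) p δ} := by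
  set t := δ / (2 * b)
  have ht : 0 < t := by positivity
  set B : ℝ → Finset V → Set (Set (Sym2 V)) := fun t X =>
    {S | |t| * (δ * (p * w.edgeWeight univ)) ≤
        t * ((w.keep S).edgeWeight X - p * w.edgeWeight X)} with hB
  have : MeasureTheory.IsProbabilityMeasure (w.edgeLaw p) := by unfold edgeLaw; infer_instance
  -- A failure of closeness is witnessed by a set `X` and a sign, hence the union over `2^|V|` sets
  -- and over `t`, `-t`.
  have hsub : {S | w.Close (w.keep S) p δ}ᶜ ⊆
      ⋃ X ∈ (univ : Finset (Finset V)), (B t X ∪ B (-t) X) := by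
    intro S hS
    simp only [Close, Set.mem_compl_iff, Set.mem_ofPred_eq, not_forall, not_le] at hS
    obtain ⟨X, hX⟩ := hS
    simp only [Set.mem_iUnion]
    refine ⟨X, mem_univ _, ?_⟩
    simp only [hB, Set.mem_union, Set.mem_ofPred_eq, abs_neg, abs_of_pos ht]
    rcases lt_abs.1 hX with h | h
    · exact .inl (mul_le_mul_of_nonneg_left h.le ht.le)
    · right
      rw [neg_mul, ← mul_neg]
      exact mul_le_mul_of_nonneg_left h.le ht.le
  have hle : (w.edgeLaw p).real {S | w.Close (w.keep S) p δ}ᶜ ≤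
      2 ^ Fintype.card V * (2 * Real.exp (-(δ ^ 2 / (4 * b) * (w.edgeWeight univ * p)))) := by
    refine (MeasureTheory.measureReal_mono hsub (MeasureTheory.measure_ne_top _ _)).trans ?_
    refine (MeasureTheory.measureReal_biUnion_finset_le _ _).trans ?_
    refine (Finset.sum_le_card_nsmul _ _
      (2 * Real.exp (-(δ ^ 2 / (4 * b) * (w.edgeWeight univ * p)))) ?_).trans_eq ?_
    · intro X _
      refine (MeasureTheory.measureReal_union_le _ _).trans ?_
      rw [two_mul]
      exact add_le_add (w.edgeLaw_tail_le p hw hb hδ hδ2 (abs_of_pos ht) X)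
        (w.edgeLaw_tail_le p hw hb hδ hδ2 (by rw [abs_neg, abs_of_pos ht]) X)
    · rw [Finset.card_univ, Fintype.card_finset, nsmul_eq_mul]
      push_cast
      rfl
  rw [MeasureTheory.probReal_compl_eq_one_sub (Set.toFinite _).measurableSet] at hle
  linarith

end WeightFunction

/-! ### Scores of labellings and their stability -/

namespace WeightFunction

variable {V : Type u} [Fintype V]

/-- The modularity score of the partition into the fibres of a labelling. -/
def labelScore (w : WeightFunction V) (f : V → ℕ) : ℝ :=
  (1 / w.vol univ) * ∑ x, ∑ y,
    if f x = f y then w.weight x y - w.deg x * w.deg y / w.vol univ else 0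

variable [DecidableEq V]

/-- Labellings are easier to merge and compare than partitions, and they are what the program
manipulates. -/
theorem score_eq_labelScore (w : WeightFunction V) (A : Finpartition (univ : Finset V))
    (f : V → ℕ) (h : ∀ x y, f x = f y ↔ A.part x = A.part y) : w.score A = w.labelScore f := by
  unfold score labelScore
  congr 1
  have h1 : ∀ X ∈ A.parts, ∑ x ∈ X, ∑ y ∈ X, (w.weight x y - w.deg x * w.deg y / w.vol univ)
      = ∑ x ∈ X, ∑ y, if f x = f y then w.weight x y - w.deg x * w.deg y / w.vol univ else 0 := by
    intro X hX
    refine Finset.sum_congr rfl fun x hx => ?_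
    rw [← Finset.sum_filter]
    refine Finset.sum_congr ?_ fun _ _ => rfl
    ext y
    rw [Finset.mem_filter, h, A.part_eq_of_mem hX hx]
    simp only [mem_univ, true_and]
    constructor
    · intro hy
      exact (A.part_eq_of_mem hX hy).symm
    · intro hy
      rw [hy]
      exact A.mem_part (mem_univ y)
  rw [Finset.sum_congr rfl h1]
  exact (Finset.sum_biUnion A.disjoint).symm.trans
    (by rw [show A.parts.biUnion id = univ from A.biUnion_parts])

theorem exists_describes (A : Finpartition (univ : Finset V)) :
    ∃ label : V → Fin (Fintype.card V), Describes label A := by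
  have hne : ∀ x, (A.part x).Nonempty := fun x => ⟨x, A.mem_part (mem_univ x)⟩
  refine ⟨fun x => Fintype.equivFin V (hne x).choose, fun x y => ?_⟩
  rw [EmbeddingLike.apply_eq_iff_eq]
  constructor
  · intro h
    have hx := (hne x).choose_spec
    have hy := (hne y).choose_spec
    rw [← h] at hy
    rw [← A.part_eq_of_mem (A.part_mem.2 (mem_univ x)) hx,
      A.part_eq_of_mem (A.part_mem.2 (mem_univ y)) hy]
  · intro h
    congr 1
    simp only [h]

theorem exists_finpartition (f : V → ℕ) :
    ∃ A : Finpartition (univ : Finset V), ∀ x y, f x = f y ↔ A.part x = A.part y := by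
  classical
  refine ⟨Finpartition.ofSetoid (Setoid.ker f), fun x y => ?_⟩
  rw [eq_comm, ← Setoid.ker_def, ← Finpartition.mem_part_ofSetoid_iff_rel]
  rw [Finpartition.mem_part_iff_part_eq_part _ (mem_univ _) (mem_univ _)]

-- Each label contributes an edge fraction minus a squared volume fraction, so perturbation errors
-- add up label by label. Unused labels contribute `0`.
omit [DecidableEq V] in
theorem labelScore_eq_sum (w : WeightFunction V) (f : V → ℕ) (k : ℕ) (hf : ∀ x, f x < k)
    (hw : w.edgeWeight univ ≠ 0) :
    w.labelScore f = ∑ l ∈ range k, (w.edgeWeight {x | f x = l} / w.edgeWeight univ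
      - (w.vol {x | f x = l} / w.vol univ) ^ 2) := by
  have h0 : w.vol univ ≠ 0 := by rw [vol_univ]; simpa
  have h1 : ∀ x ∈ (univ : Finset V), f x ∈ range k := fun x _ => Finset.mem_range.2 (hf x)
  unfold labelScore
  rw [← Finset.sum_fiberwise_of_maps_to h1, Finset.mul_sum]
  refine Finset.sum_congr rfl fun l _ => ?_
  have h2 : ∀ x ∈ ({x | f x = l} : Finset V),
      (∑ y, if f x = f y then w.weight x y - w.deg x * w.deg y / w.vol univ else 0)
      = (∑ y with f y = l, w.weight x y) - w.deg x * w.vol {x | f x = l} / w.vol univ := by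
    intro x hx
    rw [Finset.mem_filter] at hx
    rw [← Finset.sum_filter, hx.2, Finset.sum_sub_distrib, ← Finset.sum_div, ← Finset.mul_sum]
    simp_rw [eq_comm (a := l)]
    rfl
  rw [Finset.sum_congr rfl h2, Finset.sum_sub_distrib, ← Finset.sum_div, ← Finset.sum_mul,
    ← vol, mul_sub]
  congr 1
  · rw [edgeWeight, vol_univ]
    field_simp
  · field_simp

/-- The volume of `X` in terms of the weights inside `X` and inside its complement. -/
theorem vol_eq (w : WeightFunction V) (X : Finset V) :
    w.vol X = w.edgeWeight univ + w.edgeWeight X - w.edgeWeight Xᶜ := by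
  -- The weight crossing between `X` and `Xᶜ` occurs once in `vol X` and once in the total, and
  -- cancels.
  have hs : ∑ x ∈ Xᶜ, ∑ y ∈ X, w.weight x y = ∑ x ∈ X, ∑ y ∈ Xᶜ, w.weight x y := by
    rw [Finset.sum_comm]
    exact Finset.sum_congr rfl fun x _ => Finset.sum_congr rfl fun y _ => w.symm _ _
  unfold vol deg edgeWeight
  simp_rw [← Finset.sum_add_sum_compl X, Finset.sum_add_distrib, hs]
  ring

omit [DecidableEq V] in
theorem Close.edgeWeight_pos {w w' : WeightFunction V} {q δ : ℝ} (h : w.Close w' q δ)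
    (hq : 0 < q) (hδ : δ < 1) (hw : 0 < w.edgeWeight univ) : 0 < w'.edgeWeight univ := by
  have := abs_le.1 (h univ)
  have := mul_pos hq hw
  nlinarith

omit [DecidableEq V] in
theorem Close.abs_edgeWeight_div_sub_le {w w' : WeightFunction V} {q δ : ℝ} (h : w.Close w' q δ)
    (hq : 0 < q) (hδ : δ < 1) (hw : 0 < w.edgeWeight univ) (X : Finset V) :
    |w'.edgeWeight X / w'.edgeWeight univ - w.edgeWeight X / w.edgeWeight univ| ≤ 2 * δ := by
  have hw' := h.edgeWeight_pos hq hδ hw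
  have hN : 0 < q * w.edgeWeight univ := mul_pos hq hw
  -- The error splits into one from the denominator, weighted by a ratio at most `1`, and one from
  -- the numerator; each is at most `δ`.
  have e1 : w'.edgeWeight X / w'.edgeWeight univ - w.edgeWeight X / w.edgeWeight univ
      = w'.edgeWeight X / w'.edgeWeight univ *
          ((q * w.edgeWeight univ - w'.edgeWeight univ) / (q * w.edgeWeight univ))
        + (w'.edgeWeight X - q * w.edgeWeight X) / (q * w.edgeWeight univ) := by
    field_simp
    ring
  have b1 : |w'.edgeWeight X / w'.edgeWeight univ| ≤ 1 := by
    rw [abs_of_nonneg (div_nonneg (w'.edgeWeight_nonneg X) hw'.le)]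
    exact div_le_one_of_le₀ (w'.edgeWeight_le_univ X) hw'.le
  have b2 : |(q * w.edgeWeight univ - w'.edgeWeight univ) / (q * w.edgeWeight univ)| ≤ δ := by
    rw [abs_div, abs_of_pos hN, abs_sub_comm]
    rw [div_le_iff₀ hN]
    exact h univ
  have b3 : |(w'.edgeWeight X - q * w.edgeWeight X) / (q * w.edgeWeight univ)| ≤ δ := by
    rw [abs_div, abs_of_pos hN, div_le_iff₀ hN]
    exact h X
  rw [e1]
  refine (abs_add_le _ _).trans ?_
  rw [abs_mul]
  have := mul_le_mul b1 b2 (abs_nonneg _) zero_le_one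
  linarith

/-- Closeness speaks only of weights inside sets. By `vol_eq` a volume fraction is half of `1` plus
the edge fraction of `X` minus that of `Xᶜ`, so the two errors `2δ` are averaged. -/
theorem Close.abs_vol_div_sub_le {w w' : WeightFunction V} {q δ : ℝ} (h : w.Close w' q δ)
    (hq : 0 < q) (hδ : δ < 1) (hw : 0 < w.edgeWeight univ) (X : Finset V) :
    |w'.vol X / w'.vol univ - w.vol X / w.vol univ| ≤ 2 * δ := by
  have hw' := h.edgeWeight_pos hq hδ hw
  have key : ∀ w : WeightFunction V, 0 < w.edgeWeight univ → w.vol X / w.vol univ =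
      (1 + w.edgeWeight X / w.edgeWeight univ - w.edgeWeight Xᶜ / w.edgeWeight univ) / 2 := by
    intro w hw
    rw [vol_univ, vol_eq]
    field_simp
  rw [key w hw, key w' hw']
  have h1 := abs_le.1 (h.abs_edgeWeight_div_sub_le hq hδ hw X)
  have h2 := abs_le.1 (h.abs_edgeWeight_div_sub_le hq hδ hw Xᶜ)
  rw [abs_le]
  constructor <;> linarith

omit [DecidableEq V] in
theorem vol_div_mem (w : WeightFunction V) (X : Finset V) :
    0 ≤ w.vol X / w.vol univ ∧ w.vol X / w.vol univ ≤ 1 := by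
  refine ⟨div_nonneg (w.vol_nonneg X) (w.vol_nonneg univ), div_le_one_of_le₀ ?_ (w.vol_nonneg univ)⟩
  exact Finset.sum_le_sum_of_subset_of_nonneg (subset_univ X) fun x _ _ => w.deg_nonneg x

/-- Per label, the edge fraction costs `2δ` and the square of a volume fraction in `[0, 1]` costs
`4δ`. -/
theorem Close.abs_labelScore_sub_le {w w' : WeightFunction V} {q δ : ℝ} (h : w.Close w' q δ)
    (hq : 0 < q) (hδ : δ < 1) (hw : 0 < w.edgeWeight univ) (f : V → ℕ) (k : ℕ)
    (hf : ∀ x, f x < k) : |w'.labelScore f - w.labelScore f| ≤ k * (6 * δ) := by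
  have hw' := h.edgeWeight_pos hq hδ hw
  rw [labelScore_eq_sum w f k hf hw.ne', labelScore_eq_sum w' f k hf hw'.ne',
    ← Finset.sum_sub_distrib]
  refine (Finset.abs_sum_le_sum_abs _ _).trans ?_
  refine (Finset.sum_le_card_nsmul _ _ (6 * δ) ?_).trans_eq (by simp)
  intro l _
  set X : Finset V := {x | f x = l}
  have h1 := abs_le.1 (h.abs_edgeWeight_div_sub_le hq hδ hw X)
  have h2 := h.abs_vol_div_sub_le hq hδ hw X
  obtain ⟨a0, a1⟩ := w.vol_div_mem X
  obtain ⟨c0, c1⟩ := w'.vol_div_mem X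
  have h3 : |(w'.vol X / w'.vol univ) ^ 2 - (w.vol X / w.vol univ) ^ 2| ≤ 2 * δ * 2 := by
    rw [sq_sub_sq, mul_comm, abs_mul]
    exact mul_le_mul h2 (by rw [abs_of_nonneg (by linarith)]; linarith) (abs_nonneg _)
      ((abs_nonneg _).trans h2)
  have h4 := abs_le.1 h3
  rw [abs_le]
  constructor <;> linarith

end WeightFunction

/-! ### Next-fit packing -/

/-- Next-fit merging of a sequence of items of sizes `v 0, v 1, …` into bins: after `j` items, the
number of the current bin and its content. A bin is closed when its content reaches `θ`. -/
def nextFit (θ : ℝ) (v : ℕ → ℝ) : ℕ → ℕ × ℝ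
  | 0 => (0, 0)
  | j + 1 =>
    if θ ≤ (nextFit θ v j).2 + v j then ((nextFit θ v j).1 + 1, 0)
    else ((nextFit θ v j).1, (nextFit θ v j).2 + v j)

namespace nextFit

variable {θ : ℝ} {v : ℕ → ℝ}

theorem fst_succ (j : ℕ) : (nextFit θ v (j + 1)).1 =
    if θ ≤ (nextFit θ v j).2 + v j then (nextFit θ v j).1 + 1 else (nextFit θ v j).1 := by
  rw [nextFit]
  split_ifs <;> rfl

theorem snd_succ (j : ℕ) : (nextFit θ v (j + 1)).2 =
    if θ ≤ (nextFit θ v j).2 + v j then 0 else (nextFit θ v j).2 + v j := by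
  rw [nextFit]
  split_ifs <;> rfl

theorem fst_le (j : ℕ) : (nextFit θ v j).1 ≤ j := by
  induction j with
  | zero => simp [nextFit]
  | succ j ih => rw [fst_succ]; split_ifs <;> omega

theorem fst_mono : Monotone fun j => (nextFit θ v j).1 :=
  monotone_nat_of_le_succ fun j => by
    rw [fst_succ]
    split_ifs <;> omega

theorem snd_le (hθ : 0 ≤ θ) (j : ℕ) : (nextFit θ v j).2 ≤ θ := by
  induction j with
  | zero => simpa [nextFit] using hθ
  | succ j ih => rw [snd_succ]; split_ifs with h; exacts [hθ, (not_le.1 h).le]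

/-- Every closed bin holds at least `θ`; this bounds the number of bins. -/
theorem fst_mul_add_snd_le (j : ℕ) :
    (nextFit θ v j).1 * θ + (nextFit θ v j).2 ≤ ∑ i ∈ range j, v i := by
  induction j with
  | zero => simp [nextFit]
  | succ j ih =>
    rw [fst_succ, snd_succ, Finset.sum_range_succ]
    split_ifs with h
    · push_cast
      linarith
    · linarith

theorem snd_nonneg (hv : ∀ i, 0 ≤ v i) (j : ℕ) : 0 ≤ (nextFit θ v j).2 := by
  induction j with
  | zero => simp [nextFit]
  | succ j ih => rw [snd_succ]; split_ifs; exacts [le_rfl, add_nonneg ih (hv j)]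

/-- Item `i` belongs to the bin that is current before it is processed, so an item that closes a bin
still lies in it. -/
theorem snd_eq_sum (j : ℕ) : (nextFit θ v j).2 =
    ∑ i ∈ range j, if (nextFit θ v i).1 = (nextFit θ v j).1 then v i else 0 := by
  induction j with
  | zero => simp [nextFit]
  | succ j ih =>
    rw [snd_succ, fst_succ]
    split_ifs with h
    · refine (Finset.sum_eq_zero fun i hi => if_neg ?_).symm
      have : (nextFit θ v i).1 ≤ (nextFit θ v j).1 :=
        fst_mono (Nat.lt_succ_iff.1 (Finset.mem_range.1 hi))
      omega
    · rw [Finset.sum_range_succ, if_pos rfl, ← ih]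

/-- A new item is paired only with the earlier content of its bin, which is at most `θ`, and each
pair is counted in both orders. No bound on the item itself is needed, because the diagonal is
excluded. -/
theorem sum_mul_le (hθ : 0 ≤ θ) (hv : ∀ i, 0 ≤ v i) (N : ℕ) :
    ∑ i ∈ range N, ∑ j ∈ range N,
      (if (nextFit θ v i).1 = (nextFit θ v j).1 ∧ i ≠ j then 1 else 0) * v i * v j
      ≤ 2 * θ * ∑ i ∈ range N, v i := by
  induction N with
  | zero => simp
  | succ N ih =>
    simp_rw [Finset.sum_range_succ, Finset.sum_add_distrib]
    have h1 : ∑ i ∈ range N,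
        (if (nextFit θ v i).1 = (nextFit θ v N).1 ∧ i ≠ N then 1 else 0) * v i * v N
        = (nextFit θ v N).2 * v N := by
      rw [snd_eq_sum, Finset.sum_mul]
      refine Finset.sum_congr rfl fun i hi => ?_
      have : i ≠ N := (Finset.mem_range.1 hi).ne
      simp [this]
    have h2 : ∑ i ∈ range N,
        (if (nextFit θ v N).1 = (nextFit θ v i).1 ∧ N ≠ i then 1 else 0) * v N * v i
        = (nextFit θ v N).2 * v N := by
      rw [← h1]
      refine Finset.sum_congr rfl fun i _ => ?_
      simp_rw [eq_comm (a := (nextFit θ v N).1), ne_comm (a := N)]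
      ring
    rw [h1, h2]
    have h3 := mul_le_mul_of_nonneg_right (snd_le (v := v) hθ N) (hv N)
    simp only [ne_eq, not_true_eq_false, and_false, if_false, zero_mul, add_zero]
    linarith

end nextFit

/-! ### Merging the classes of a labelling by volume -/

namespace WeightFunction

variable {V : Type u} [Fintype V]

/-- The total degree of the vertices with label `l`. -/
def labelVol (w : WeightFunction V) (f : V → ℕ) (l : ℕ) : ℝ := w.vol {x | f x = l}

theorem sum_mul_deg (w : WeightFunction V) (f : V → ℕ) (N : ℕ) (hf : ∀ x, f x < N) (g : ℕ → ℝ) :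
    ∑ x, g (f x) * w.deg x = ∑ l ∈ range N, g l * w.labelVol f l := by
  rw [← Finset.sum_fiberwise_of_maps_to
    (fun x _ => Finset.mem_range.2 (hf x) : ∀ x ∈ univ, f x ∈ range N)]
  refine Finset.sum_congr rfl fun l _ => ?_
  rw [labelVol, vol, Finset.mul_sum]
  refine Finset.sum_congr rfl fun x hx => ?_
  rw [(Finset.mem_filter.1 hx).2]

theorem sum_labelVol (w : WeightFunction V) (f : V → ℕ) (N : ℕ) (hf : ∀ x, f x < N) :
    ∑ l ∈ range N, w.labelVol f l = w.vol univ := by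
  have := w.sum_mul_deg f N hf fun _ => 1
  simpa [vol] using this.symm

/-- The labelling in which the classes of `f` are merged by the next-fit rule with threshold
`η` times the total volume. -/
def mergeLabel (w : WeightFunction V) (η : ℝ) (f : V → ℕ) (x : V) : ℕ :=
  (nextFit (η * w.vol univ) (w.labelVol f) (f x)).1

theorem mergeLabel_le (w : WeightFunction V) (η : ℝ) (f : V → ℕ) (x : V) :
    w.mergeLabel η f x ≤ f x := nextFit.fst_le _

theorem mergeLabel_le_inv (w : WeightFunction V) {η : ℝ} (hη : 0 < η) (hw : 0 < w.vol univ)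
    (f : V → ℕ) (x : V) : (w.mergeLabel η f x : ℝ) ≤ 1 / η := by
  obtain ⟨N, hN⟩ : ∃ N, ∀ x, f x < N :=
    ⟨∑ x, (f x + 1), fun x => (Finset.single_le_sum (f := fun x => f x + 1)
      (fun _ _ => Nat.zero_le _) (mem_univ x))⟩
  have h0 : ∀ l, 0 ≤ w.labelVol f l := fun l => w.vol_nonneg _
  have h1 := nextFit.fst_mul_add_snd_le (θ := η * w.vol univ) (v := w.labelVol f) (f x)
  have h2 := nextFit.snd_nonneg (θ := η * w.vol univ) h0 (f x)
  have h3 : ∑ i ∈ range (f x), w.labelVol f i ≤ ∑ i ∈ range N, w.labelVol f i :=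
    Finset.sum_le_sum_of_subset_of_nonneg (Finset.range_subset_range.2 (hN x).le)
      fun i _ _ => h0 i
  rw [w.sum_labelVol f N hN] at h3
  rw [le_div_iff₀ hη, mergeLabel]
  nlinarith

/-- Merging by the next-fit rule loses at most `2η` in the modularity score. -/
theorem labelScore_mergeLabel (w : WeightFunction V) {η : ℝ} (hη : 0 < η) (hw : 0 < w.vol univ)
    (f : V → ℕ) : w.labelScore f - 2 * η ≤ w.labelScore (w.mergeLabel η f) := by
  obtain ⟨N, hN⟩ : ∃ N, ∀ x, f x < N :=
    ⟨∑ x, (f x + 1), fun x => (Finset.single_le_sum (f := fun x => f x + 1)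
      (fun _ _ => Nat.zero_le _) (mem_univ x))⟩
  have h0 : ∀ l, 0 ≤ w.labelVol f l := fun l => w.vol_nonneg _
  set θ := η * w.vol univ with hθ
  set c : ℕ → ℕ → ℝ := fun i j => if (nextFit θ (w.labelVol f) i).1 =
    (nextFit θ (w.labelVol f) j).1 ∧ i ≠ j then 1 else 0 with hc
  have hsum : ∑ x, ∑ y, c (f x) (f y) * w.deg x * w.deg y ≤ 2 * θ * w.vol univ := by
    have h1 := nextFit.sum_mul_le (θ := θ) (mul_pos hη hw).le h0 N
    rw [w.sum_labelVol f N hN] at h1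
    refine le_of_eq_of_le ?_ h1
    calc ∑ x, ∑ y, c (f x) (f y) * w.deg x * w.deg y
        = ∑ x, (∑ j ∈ range N, c (f x) j * w.labelVol f j) * w.deg x := by
          refine Finset.sum_congr rfl fun x _ => ?_
          rw [← w.sum_mul_deg f N hN (c (f x)), Finset.sum_mul]
          exact Finset.sum_congr rfl fun y _ => by ring
      _ = ∑ i ∈ range N, (∑ j ∈ range N, c i j * w.labelVol f j) * w.labelVol f i :=
          w.sum_mul_deg f N hN fun i => ∑ j ∈ range N, c i j * w.labelVol f j
      _ = _ := by
          refine Finset.sum_congr rfl fun i _ => ?_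
          rw [Finset.sum_mul]
          exact Finset.sum_congr rfl fun j _ => by ring
  -- Only pairs whose distinct classes share a bin change. Their new term is at least minus the
  -- degree product over the volume, as weights are nonnegative.
  have hterm : ∀ x y,
      (if f x = f y then w.weight x y - w.deg x * w.deg y / w.vol univ else 0)
        - c (f x) (f y) * w.deg x * w.deg y / w.vol univ ≤
      if w.mergeLabel η f x = w.mergeLabel η f y then
        w.weight x y - w.deg x * w.deg y / w.vol univ else 0 := by
    intro x y
    have := w.nonneg x y
    simp only [hc, mergeLabel, ← hθ]
    by_cases h : f x = f y
    · simp [h]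
    · by_cases h' : (nextFit θ (w.labelVol f) (f x)).1 = (nextFit θ (w.labelVol f) (f y)).1
      · simp [h, h', this]
      · simp [h, h']
  have hle := Finset.sum_le_sum fun x (_ : x ∈ univ) =>
    Finset.sum_le_sum fun y (_ : y ∈ univ) => hterm x y
  simp_rw [Finset.sum_sub_distrib, ← Finset.sum_div] at hle
  have hle2 := mul_le_mul_of_nonneg_left hle (one_div_pos.2 hw).le
  rw [mul_sub] at hle2
  have h5 : 1 / w.vol univ * ((∑ x, ∑ y, c (f x) (f y) * w.deg x * w.deg y) / w.vol univ)
      ≤ 2 * η := by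
    rw [one_div_mul_eq_div, div_div, div_le_iff₀ (mul_pos hw hw)]
    refine hsum.trans_eq ?_
    rw [hθ]
    ring
  unfold labelScore
  linarith

end WeightFunction

/-! ### The program: running time and correctness -/

namespace Program

/-- The program executing a list of instructions. -/
def block : List Instr → Program
  | [] => skip
  | i :: l => seq (instr i) (block l)

/-- The extra step is the `skip` that ends every block. -/
theorem runs_block (l : List Instr) (s : Store) :
    (block l).Runs s (l.length + 1) (l.foldl (fun s i => i.exec s) s) := by
  induction l generalizing s with
  | nil => exact .skip s
  | cons i l ih =>
    have := Runs.seq (.instr i s) (ih (i.exec s))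
    rwa [add_comm 1] at this

/-- `P` takes every memory satisfying `pre` to one satisfying `post` in at most `T` steps. -/
def Takes (P : Program) (pre : Store → Prop) (T : ℕ) (post : Store → Prop) : Prop :=
  ∀ s, pre s → ∃ t ≤ T, ∃ s', P.Runs s t s' ∧ post s'

theorem Takes.mono {P : Program} {pre post : Store → Prop} {T T' : ℕ} (h : P.Takes pre T post)
    (hT : T ≤ T') : P.Takes pre T' post := fun s hs =>
  let ⟨t, ht, s', h₁, h₂⟩ := h s hs
  ⟨t, ht.trans hT, s', h₁, h₂⟩

theorem Takes.seq {P Q : Program} {pre mid post : Store → Prop} {T₁ T₂ : ℕ}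
    (hP : P.Takes pre T₁ mid) (hQ : Q.Takes mid T₂ post) : (P.seq Q).Takes pre (T₁ + T₂) post := by
  intro s hs
  obtain ⟨t₁, h₁, s₁, r₁, m₁⟩ := hP s hs
  obtain ⟨t₂, h₂, s₂, r₂, m₂⟩ := hQ s₁ m₁
  exact ⟨t₁ + t₂, add_le_add h₁ h₂, s₂, r₁.seq r₂, m₂⟩

theorem takes_block (l : List Instr) {pre post : Store → Prop}
    (h : ∀ s, pre s → post (l.foldl (fun s i => i.exec s) s)) :
    (block l).Takes pre (l.length + 1) post :=
  fun s hs => ⟨_, le_rfl, _, runs_block l s, h s hs⟩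

theorem takes_cond {b : Test} {P Q : Program} {pre post : Store → Prop} {T : ℕ}
    (hP : P.Takes (fun s => pre s ∧ b.Holds s) T post)
    (hQ : Q.Takes (fun s => pre s ∧ ¬ b.Holds s) T post) :
    (cond b P Q).Takes pre (T + 1) post := by
  intro s hs
  by_cases hb : b.Holds s
  · obtain ⟨t, ht, s', r, h⟩ := hP s ⟨hs, hb⟩
    exact ⟨t + 1, by omega, s', .cond_true hb r, h⟩
  · obtain ⟨t, ht, s', r, h⟩ := hQ s ⟨hs, hb⟩
    exact ⟨t + 1, by omega, s', .cond_false hb r, h⟩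

theorem takes_loop {b : Test} {P : Program} {T N : ℕ} (inv : ℕ → Store → Prop)
    (hb : ∀ i ≤ N, ∀ s, inv i s → (b.Holds s ↔ i < N))
    (hP : ∀ i < N, P.Takes (inv i) T (inv (i + 1))) :
    (loop b P).Takes (inv 0) (N * (T + 1) + 1) (inv N) := by
  suffices H : ∀ k i, i + k = N → (loop b P).Takes (inv i) (k * (T + 1) + 1) (inv N) from
    H N 0 (zero_add N)
  intro k
  induction k with
  | zero =>
    rintro i rfl s hs
    exact ⟨1, by omega, s, .loop_false fun h => lt_irrefl _ ((hb i le_rfl s hs).1 h), hs⟩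
  | succ k ih =>
    intro i hi s hs
    obtain ⟨t₁, h₁, s₁, r₁, m₁⟩ := hP i (by omega) s hs
    obtain ⟨t₂, h₂, s₂, r₂, m₂⟩ := ih (i + 1) (by omega) s₁ m₁
    refine ⟨t₁ + t₂ + 1, ?_, s₂, .loop_true ((hb i (by omega) s hs).2 (by omega)) r₁ r₂, m₂⟩
    rw [add_mul]
    omega

/-- The instructions that add the weight of the current edge to the volumes of the classes of its
two ends and to the total volume. -/
def addEdge : List Instr :=
  [.nload 4 0 3, .nload 4 2 4, .rload 1 0 3, .rload 2 1 4, .radd 2 2 1, .rstore 1 4 2,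
    .nload 4 1 3, .nload 4 2 4, .rload 2 1 4, .radd 2 2 1, .rstore 1 4 2,
    .radd 3 3 1, .radd 3 3 1, .nadd 3 3 2]

/-- The conversion program: it computes the volumes of the classes, merges the classes by the
next-fit rule with threshold `ε / 8` times the total volume, and relabels the vertices. -/
def convert : Program :=
  -- Natural registers: `2` is the constant one, `3` the loop counter, `4` scratch, `5` the current
  -- bin. Real registers: `3` is the total volume, `5` the threshold, `6` the bin content. Real
  -- array `1` holds class volumes, natural array `4` the bin of each class.
  .seq (block [.nconst 2 1]) <|
  .seq (loop (.nlt 3 1) (block addEdge)) <|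
  .seq (block [.rconst 4 8, .rdiv 5 0 4, .rmul 5 5 3, .nconst 3 0]) <|
  .seq (loop (.nlt 3 0) <|
    -- The bin is recorded before the test, so a class that closes a bin is put into that bin.
    .seq (block [.rload 2 1 3, .radd 6 6 2, .nstore 4 3 5]) <|
    .seq (cond (.rle 5 6) (block [.nadd 5 5 2, .rconst 6 0]) (block [])) (block [.nadd 3 3 2])) <|
  .seq (block [.nconst 3 0]) <|
    loop (.nlt 3 0) (block [.nload 4 2 3, .nload 4 4 4, .nstore 3 3 4, .nadd 3 3 2])

section

variable (n m : ℕ) (a b lab : ℕ → ℕ) (W : ℕ → ℝ) (ε : ℝ)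

/-- The volume of class `l` in the graph formed by the first `i` listed edges. -/
def partialVol (i l : ℕ) : ℝ :=
  ∑ j ∈ range i, ((if lab (a j) = l then W j else 0) + if lab (b j) = l then W j else 0)

/-- The fields `n5` and `r6` are kept because the packing loop starts from bin `0` with content `0`
without initialising them. -/
structure VolInv (i : ℕ) (s : Store) : Prop where
  n0 : s.nreg 0 = n
  n1 : s.nreg 1 = m
  n2 : s.nreg 2 = 1
  n3 : s.nreg 3 = i
  n5 : s.nreg 5 = 0
  a0 : s.narr 0 = a
  a1 : s.narr 1 = b
  a2 : s.narr 2 = lab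
  r0 : s.rreg 0 = ε
  r3 : s.rreg 3 = ∑ j ∈ range i, (W j + W j)
  r6 : s.rreg 6 = 0
  w0 : s.rarr 0 = W
  w1 : ∀ l, s.rarr 1 l = partialVol a b lab W i l

theorem addEdge_takes (i : ℕ) :
    (block addEdge).Takes (VolInv n m a b lab W ε i) 15 (VolInv n m a b lab W ε (i + 1)) := by
  refine takes_block _ fun s h => ?_
  have hw : ∀ l, s.rarr 1 l = partialVol a b lab W i l := h.w1
  constructor
  case w1 =>
    intro l
    rw [partialVol, Finset.sum_range_succ, ← partialVol]
    simp [addEdge, Instr.exec, Function.update_apply, h.n3, h.a0, h.a1, h.a2, h.w0, hw]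
    -- Both ends may lie in the same class; the second read then sees the first update.
    grind
  all_goals
    simp [addEdge, Instr.exec, Finset.sum_range_succ, h.n0, h.n1, h.n2, h.n3, h.n5, h.a0,
      h.a1, h.a2, h.r0, h.r3, h.r6, h.w0]
  ring

structure BinInv (v : ℕ → ℝ) (θ : ℝ) (j : ℕ) (s : Store) : Prop where
  n0 : s.nreg 0 = n
  n2 : s.nreg 2 = 1
  n3 : s.nreg 3 = j
  n5 : s.nreg 5 = (nextFit θ v j).1
  a2 : s.narr 2 = lab
  a4 : ∀ i < j, s.narr 4 i = (nextFit θ v i).1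
  r5 : s.rreg 5 = θ
  r6 : s.rreg 6 = (nextFit θ v j).2
  w1 : s.rarr 1 = v

/-- The memory in the middle of a step of the next-fit rule, with current bin `q.1` of content
`q.2`. -/
structure BinMid (v : ℕ → ℝ) (θ : ℝ) (j : ℕ) (q : ℕ × ℝ) (s : Store) : Prop where
  n0 : s.nreg 0 = n
  n2 : s.nreg 2 = 1
  n3 : s.nreg 3 = j
  n5 : s.nreg 5 = q.1
  a2 : s.narr 2 = lab
  a4 : ∀ i < j + 1, s.narr 4 i = (nextFit θ v i).1
  r5 : s.rreg 5 = θ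
  r6 : s.rreg 6 = q.2
  w1 : s.rarr 1 = v

theorem bin_takes (v : ℕ → ℝ) (θ : ℝ) (j : ℕ) :
    (Program.seq (block [.rload 2 1 3, .radd 6 6 2, .nstore 4 3 5]) <|
      .seq (cond (.rle 5 6) (block [.nadd 5 5 2, .rconst 6 0]) (block []))
        (block [.nadd 3 3 2])).Takes
      (BinInv n lab v θ j) 10 (BinInv n lab v θ (j + 1)) := by
  refine Takes.seq (T₁ := 4) (mid := BinMid n lab v θ j
    ((nextFit θ v j).1, (nextFit θ v j).2 + v j)) (takes_block _ fun s h => ?_)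
    (Takes.seq (T₁ := 4) (T₂ := 2) (mid := BinMid n lab v θ j (nextFit θ v (j + 1)))
      (takes_cond (T := 3) (takes_block _ fun s h => ?_)
        (.mono (T := 1) (takes_block _ fun s h => ?_) (by norm_num)))
      (takes_block _ fun s h => ?_))
  · constructor
    case a4 =>
      intro i hi
      rcases Nat.lt_succ_iff_lt_or_eq.1 hi with hi | rfl
      · simp [Instr.exec, h.n3, hi.ne, h.a4 i hi]
      · simp [Instr.exec, h.n3, h.n5]
    all_goals simp [Instr.exec, h.n0, h.n2, h.n3, h.n5, h.a2, h.r5, h.r6, h.w1]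
  · obtain ⟨h, hb⟩ := h
    simp only [Test.Holds, h.r5, h.r6] at hb
    constructor
    case a4 => exact h.a4
    all_goals simp [Instr.exec, nextFit, hb, h.n0, h.n2, h.n3, h.n5, h.a2, h.r5, h.w1]
  · obtain ⟨h, hb⟩ := h
    simp only [Test.Holds, h.r5, h.r6] at hb
    rw [nextFit, if_neg hb]
    exact h
  · constructor
    case a4 => exact h.a4
    all_goals simp [Instr.exec, h.n0, h.n2, h.n3, h.n5, h.a2, h.r5, h.r6, h.w1]

structure OutInv (g : ℕ → ℕ) (i : ℕ) (s : Store) : Prop where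
  n0 : s.nreg 0 = n
  n2 : s.nreg 2 = 1
  n3 : s.nreg 3 = i
  a2 : s.narr 2 = lab
  a4 : ∀ k < n, s.narr 4 k = g k
  a3 : ∀ k < i, s.narr 3 k = g (lab k)

theorem out_takes (g : ℕ → ℕ) (hlab : ∀ k < n, lab k < n) (i : ℕ) (hi : i < n) :
    (block [.nload 4 2 3, .nload 4 4 4, .nstore 3 3 4, .nadd 3 3 2]).Takes
      (OutInv n lab g i) 5 (OutInv n lab g (i + 1)) := by
  refine takes_block _ fun s h => ?_
  constructor
  case a3 =>
    intro k hk
    rcases Nat.lt_succ_iff_lt_or_eq.1 hk with hk | rfl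
    · simp [Instr.exec, h.n3, hk.ne, h.a3 k hk]
    · simp [Instr.exec, h.n3, h.a2, h.a4 _ (hlab k hi)]
  case a4 => exact h.a4
  all_goals simp [Instr.exec, h.n0, h.n2, h.n3, h.a2]

theorem convert_takes (hlab : ∀ k < n, lab k < n) (hn : 0 < n) :
    convert.Takes (fun s => (VolInv n m a b lab W ε 0 { s with nreg := Function.update s.nreg 2 1 }))
      (100 * (n + m))
      (fun s => ∀ k < n, s.narr 3 k =
        (nextFit (ε / 8 * ∑ j ∈ range m, (W j + W j)) (partialVol a b lab W m) (lab k)).1) := by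
  set θ := ε / 8 * ∑ j ∈ range m, (W j + W j) with hθ
  set v := partialVol a b lab W m
  -- The total is `17n + 16m + 12`; the additive constant is absorbed because `n` is positive.
  refine Takes.mono (T := 2 + ((m * 16 + 1) + (5 + ((n * 11 + 1) + (2 + (n * 6 + 1)))))) ?_
    (by omega)
  refine Takes.seq (mid := VolInv n m a b lab W ε 0) (takes_block _ fun s h => h) <|
    Takes.seq (takes_loop (VolInv n m a b lab W ε) (fun i _ s h => ?_)
      (fun i _ => addEdge_takes n m a b lab W ε i)) <|
    Takes.seq (mid := BinInv n lab v θ 0) (takes_block _ fun s h => ?_) <|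
    Takes.seq (takes_loop (BinInv n lab v θ) (fun i _ s h => ?_)
      (fun i _ => bin_takes n lab v θ i)) <|
    Takes.seq (mid := OutInv n lab (fun k => (nextFit θ v k).1) 0) (takes_block _ fun s h => ?_) ?_
  · simp [Test.Holds, h.n1, h.n3]
  · constructor
    case a4 => simp
    case w1 => exact funext h.w1
    all_goals simp [Instr.exec, nextFit, h.n0, h.n2, h.n5, h.a2, h.r0, h.r3, h.r6, hθ]
  · simp [Test.Holds, h.n0, h.n3]
  · constructor
    case a4 => exact h.a4
    all_goals simp [Instr.exec, h.n0, h.n2, h.a2]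
  · intro s hs
    obtain ⟨t, ht, s', r, h⟩ := takes_loop (OutInv n lab fun k => (nextFit θ v k).1)
      (b := .nlt 3 0) (fun i _ s h => by simp [Test.Holds, h.n0, h.n3])
      (fun i hi => out_takes n lab _ hlab i hi) s hs
    exact ⟨t, ht, s', r, h.a3⟩

end

end Program

/-! ### Comparing modularities -/

namespace WeightFunction

variable {V : Type u} [Fintype V] [DecidableEq V]

theorem score_le_modularity (w : WeightFunction V) (A : Finpartition (univ : Finset V)) :
    w.score A ≤ w.modularity := Finset.le_sup' w.score (mem_univ A)

theorem exists_score_eq_modularity (w : WeightFunction V) :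
    ∃ A : Finpartition (univ : Finset V), w.score A = w.modularity := by
  obtain ⟨A, -, hA⟩ := Finset.exists_mem_eq_sup'
    (⟨⊥, mem_univ _⟩ : (univ : Finset (Finpartition (univ : Finset V))).Nonempty) w.score
  exact ⟨A, hA.symm⟩

/-- If the scores of two weight functions are close on partitions into few parts, then so are
their modularities. -/
theorem modularity_sub_le {w w' : WeightFunction V} (hw : 0 < w.vol univ) {η γ : ℝ} (hη : 0 < η)
    (h : ∀ f : V → ℕ, (∀ x, (f x : ℝ) ≤ 1 / η) → w.labelScore f ≤ w'.labelScore f + γ) :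
    w.modularity - 2 * η - γ ≤ w'.modularity := by
  obtain ⟨A, hA⟩ := w.exists_score_eq_modularity
  obtain ⟨label, hl⟩ := exists_describes A
  have h1 := w.score_eq_labelScore A (fun x => label x) fun x y =>
    Fin.val_inj.trans (hl x y)
  have h2 := w.labelScore_mergeLabel hη hw fun x => label x
  have h3 := h _ (w.mergeLabel_le_inv hη hw fun x => label x)
  obtain ⟨B, hB⟩ := exists_finpartition (w.mergeLabel η fun x => label x)
  have h4 := w'.score_eq_labelScore B _ hB
  have h5 := w'.score_le_modularity B
  linarith

end WeightFunction

/-! ### From the input memory to class volumes -/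

namespace Encoding

variable {V : Type u} [Fintype V] [DecidableEq V] {w : WeightFunction V}
  {A : Finpartition (univ : Finset V)}

/-- A sum over ordered pairs of vertices, as a sum over the list of edges. -/
theorem sum_sum_eq (E : Encoding w A) (F : V → V → ℝ) (hF : ∀ x y, w.weight x y = 0 → F x y = 0) :
    ∑ x, ∑ y, F x y = (E.edges.map fun q => F q.1 q.2 + F q.2 q.1).sum := by
  classical
  -- Listed edges are not loops, so each has exactly two distinct orientations.
  have hne : ∀ q ∈ E.edges, q.1 ≠ q.2 := by
    intro q hq h
    have := (E.mem_edges s(q.1, q.2)).1 (List.mem_map.2 ⟨q, hq, rfl⟩)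
    rw [SimpleGraph.mem_edgeSet, h] at this
    exact w.graph.irrefl this
  set G : Sym2 V → ℝ := fun e => ∑ q : V × V with s(q.1, q.2) = e, F q.1 q.2 with hG
  have h1 : (E.edges.map fun q => F q.1 q.2 + F q.2 q.1) =
      (E.edges.map fun q => s(q.1, q.2)).map G := by
    rw [List.map_map]
    refine List.map_congr_left fun q hq => ?_
    have : ({r | s(r.1, r.2) = s(q.1, q.2)} : Finset (V × V)) = {(q.1, q.2), (q.2, q.1)} := by
      ext r
      simp [Prod.ext_iff]
    simp only [Function.comp, hG]
    rw [this, Finset.sum_pair]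
    simp only [ne_eq, Prod.mk.injEq, not_and]
    exact fun h => absurd h (hne q hq)
  rw [h1, ← List.sum_toFinset G E.edges_nodup, ← Fintype.sum_prod_type',
    ← Finset.sum_fiberwise _ fun q : V × V => s(q.1, q.2)]
  symm
  refine Finset.sum_subset (subset_univ _) fun e _ he => Finset.sum_eq_zero fun q hq => hF _ _ ?_
  rw [List.mem_toFinset, E.mem_edges, ← (Finset.mem_filter.1 hq).2, SimpleGraph.mem_edgeSet] at he
  exact le_antisymm (not_lt.1 he) (w.nonneg _ _)

/-- The label of a vertex as a natural number. -/
def natLabel (E : Encoding w A) (x : V) : ℕ := E.label x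

theorem store_label (E : Encoding w A) (ε : ℝ) (x : V) :
    (E.store ε).narr 2 (E.enum x) = E.natLabel x := by
  simp [store, natLabel]

theorem store_sum (E : Encoding w A) (ε : ℝ) (H : ℕ → ℕ → ℝ → ℝ) :
    ∑ j ∈ range E.edges.length,
      H ((E.store ε).narr 0 j) ((E.store ε).narr 1 j) ((E.store ε).rarr 0 j)
      = (E.edges.map fun q => H (E.enum q.1) (E.enum q.2) (w.weight q.1 q.2)).sum := by
  rw [Finset.sum_range, ← Fin.sum_univ_fun_getElem]
  exact Finset.sum_congr rfl fun j _ => by simp [store]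

theorem store_total (E : Encoding w A) (ε : ℝ) :
    ∑ j ∈ range E.edges.length, ((E.store ε).rarr 0 j + (E.store ε).rarr 0 j) = w.vol univ := by
  rw [E.store_sum ε fun _ _ z => z + z]
  unfold WeightFunction.vol WeightFunction.deg
  rw [E.sum_sum_eq _ fun _ _ h => h]
  congr 1
  exact List.map_congr_left fun q _ => by rw [w.symm q.2 q.1]

theorem store_partialVol (E : Encoding w A) (ε : ℝ) :
    Program.partialVol ((E.store ε).narr 0) ((E.store ε).narr 1) ((E.store ε).narr 2)
      ((E.store ε).rarr 0) E.edges.length = w.labelVol E.natLabel := by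
  funext l
  rw [Program.partialVol, E.store_sum ε fun a b z =>
    (if (E.store ε).narr 2 a = l then z else 0) + if (E.store ε).narr 2 b = l then z else 0]
  have h : w.labelVol E.natLabel l =
      ∑ x, ∑ y, if E.natLabel x = l then w.weight x y else 0 := by
    rw [WeightFunction.labelVol, WeightFunction.vol, Finset.sum_filter]
    refine Finset.sum_congr rfl fun x _ => ?_
    split_ifs
    · rfl
    · simp
  rw [h, E.sum_sum_eq _ fun x y h => by rw [h, ite_self]]
  congr 1
  refine List.map_congr_left fun q _ => ?_
  rw [E.store_label, E.store_label, w.symm q.2 q.1]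

theorem store_volInv (E : Encoding w A) (ε : ℝ) :
    Program.VolInv (Fintype.card V) E.edges.length ((E.store ε).narr 0) ((E.store ε).narr 1)
      ((E.store ε).narr 2) ((E.store ε).rarr 0) ε 0
      { E.store ε with nreg := Function.update (E.store ε).nreg 2 1 } := by
  constructor
  all_goals simp [store, Program.partialVol]

/-- The conversion program outputs the partition given by the merged labelling. -/
theorem convert_outputs [Nonempty V] (E : Encoding w A) (ε : ℝ) :
    ∃ A' : Finpartition (univ : Finset V), Program.convert.Outputs E ε (100 * E.size) A' ∧
      ∀ x y, w.mergeLabel (ε / 8) E.natLabel x = w.mergeLabel (ε / 8) E.natLabel y ↔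
        A'.part x = A'.part y := by
  obtain ⟨A', hA'⟩ := WeightFunction.exists_finpartition (w.mergeLabel (ε / 8) E.natLabel)
  refine ⟨A', ?_, hA'⟩
  obtain ⟨t, ht, s, hr, hs⟩ := Program.convert_takes (Fintype.card V) E.edges.length
    ((E.store ε).narr 0) ((E.store ε).narr 1) ((E.store ε).narr 2) ((E.store ε).rarr 0) ε
    (fun k hk => by simp [store, hk]) Fintype.card_pos (E.store ε) (E.store_volInv ε)
  rw [E.store_total, E.store_partialVol] at hs
  -- Next-fit never increases a label, so the new labels still lie below `|V|`.
  refine ⟨t, s, fun x => ⟨w.mergeLabel (ε / 8) E.natLabel x,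
    (w.mergeLabel_le _ _ x).trans_lt (E.label x).2⟩, hr, ht, fun x => ?_, fun x y => ?_⟩
  · rw [hs _ (E.enum x).2, E.store_label]
    rfl
  · rw [Fin.mk.injEq, hA']

end Encoding

/-! ### Choice of constants and conclusion -/

/-- Replacing `2` by `e` gives exponent `n + 1 - x ≤ -1/ε` since `n ≥ 1`, and `e^(-1/ε) ≤ ε`. -/
theorem two_pow_mul_exp_le {n : ℕ} (hn : 0 < n) {ε x : ℝ} (hε : 0 < ε)
    (hx : (2 + 1 / ε) * n ≤ x) : 2 ^ n * (2 * Real.exp (-x)) ≤ ε := by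
  have hn1 : (1 : ℝ) ≤ n := by exact_mod_cast hn
  have h2 : (2 : ℝ) ≤ Real.exp 1 := by
    have := Real.add_one_le_exp 1
    linarith
  have h2n : (2 : ℝ) ^ n ≤ Real.exp n := by
    have := pow_le_pow_left₀ zero_le_two h2 n
    rwa [← Real.exp_nat_mul, mul_one] at this
  have he : Real.exp (-(1 / ε)) ≤ ε := by
    rw [Real.exp_neg, inv_le_comm₀ (Real.exp_pos _) hε, ← one_div]
    have := Real.add_one_le_exp (1 / ε)
    linarith
  refine le_trans ?_ he
  calc 2 ^ n * (2 * Real.exp (-x)) ≤ Real.exp n * (Real.exp 1 * Real.exp (-x)) := by gcongr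
    _ = Real.exp (n + (1 + -x)) := by rw [Real.exp_add, Real.exp_add]
    _ ≤ _ := by
      rw [Real.exp_le_exp]
      have : 1 / ε * 1 ≤ 1 / ε * n := mul_le_mul_of_nonneg_left hn1 (one_div_pos.2 hε).le
      linarith

end

theorem theorem6p2 :
    ∃ (P : Program) (K : ℕ),
      -- on every input, the program converts the partition in a linear number of steps
      (∀ (V : Type u) [Fintype V] [DecidableEq V] [Nonempty V] (w : WeightFunction V)
        (A : Finpartition (univ : Finset V)) (E : Encoding w A) (ε : ℝ), 0 < ε →
          ∃ A' : Finpartition (univ : Finset V), P.Outputs E ε (K * E.size) A') ∧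
      ∀ b ε : ℝ, 0 < b → 0 < ε → ∃ c : ℝ, 0 < c ∧
        ∀ (V : Type u) [Fintype V] [DecidableEq V] [Nonempty V] (w : WeightFunction V) (p : I),
          0 < p → w.Bounded b → c * (Fintype.card V : ℝ) ≤ w.edgeWeight univ * (p : ℝ) →
          1 - ε ≤ (w.edgeLaw p).real
            {S | |(w.keep S).modularity - w.modularity| < ε ∧
              ∀ (A : Finpartition (univ : Finset V)) (E : Encoding (w.keep S) A),
                ∃ A' : Finpartition (univ : Finset V),
                  P.Outputs E ε (K * E.size) A' ∧
                  w.deficit A' < (w.keep S).deficit A + ε} := by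
  refine ⟨Program.convert, 100, fun V _ _ _ w A E ε _ =>
    let ⟨A', h, _⟩ := E.convert_outputs ε; ⟨A', h⟩, fun b ε hb hε => ?_⟩
  have hη : 0 < ε / 8 := by positivity
  -- Merging with `η = ε/8`, the program's threshold, leaves labels at most `8/ε`, hence below `k`;
  -- `δ` then makes the score error `6kδ` at most `ε/8`.
  set k : ℕ := ⌊1 / (ε / 8)⌋₊ + 1 with hk
  have hk0 : (0 : ℝ) < k := by positivity
  set δ : ℝ := min (1 / 2) (ε / (48 * k)) with hδ
  have hδ0 : 0 < δ := lt_min (by norm_num) (by positivity)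
  have hδ1 : δ ≤ 1 / 2 := min_le_left _ _
  have hγ : k * (6 * δ) ≤ ε / 8 := by
    have : δ ≤ ε / (48 * k) := min_le_right _ _
    rw [le_div_iff₀ (by positivity)] at this
    linarith
  -- This `c` makes the tail exponent at least `(2 + 1/ε)|V|`.
  refine ⟨4 * b / δ ^ 2 * (2 + 1 / ε), by positivity, fun V _ _ _ w p hp hw hc => ?_⟩
  have hn : 0 < Fintype.card V := Fintype.card_pos
  have hp' : (0 : ℝ) < p := hp
  have hM : 0 < w.edgeWeight univ := by
    have h1 : 0 < 4 * b / δ ^ 2 * (2 + 1 / ε) * (Fintype.card V : ℝ) := by positivity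
    exact pos_of_mul_pos_left (h1.trans_le hc) hp'.le
  have hprob := w.edgeLaw_close p hw hb hδ0 (by linarith)
  have hsmall := two_pow_mul_exp_le hn hε
    (x := δ ^ 2 / (4 * b) * (w.edgeWeight univ * p)) (by
      have := mul_le_mul_of_nonneg_left hc (show 0 ≤ δ ^ 2 / (4 * b) by positivity)
      refine le_of_eq_of_le ?_ this
      field_simp)
  have hfin : MeasureTheory.IsProbabilityMeasure (w.edgeLaw p) := by
    unfold WeightFunction.edgeLaw
    infer_instance
  refine le_trans (by linarith) (hprob.trans
    (MeasureTheory.measureReal_mono ?_ (MeasureTheory.measure_ne_top _ _)))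
  intro S hS
  have hS : w.Close (w.keep S) p δ := hS
  have hM' := hS.edgeWeight_pos hp' (by linarith) hM
  have hv : 0 < w.vol univ := by rw [w.vol_univ]; linarith
  have hv' : 0 < (w.keep S).vol univ := by rw [(w.keep S).vol_univ]; linarith
  have hclose : ∀ f : V → ℕ, (∀ x, (f x : ℝ) ≤ 1 / (ε / 8)) →
      |(w.keep S).labelScore f - w.labelScore f| ≤ ε / 8 := fun f hf =>
    (hS.abs_labelScore_sub_le hp' (by linarith) hM f k fun x =>
      Nat.lt_succ_of_le (Nat.le_floor (hf x))).trans hγ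
  have hup := WeightFunction.modularity_sub_le (w' := w.keep S) (γ := ε / 8) hv hη fun f hf => by
    have := abs_le.1 (hclose f hf)
    linarith
  have hdown := WeightFunction.modularity_sub_le (w' := w) (γ := ε / 8) hv' hη fun f hf => by
    have := abs_le.1 (hclose f hf)
    linarith
  -- Each direction loses `2η + ε/8 = 3ε/8`.
  refine ⟨abs_lt.2 ⟨by linarith, by linarith⟩, fun A E => ?_⟩
  obtain ⟨A', hout, hA'⟩ := E.convert_outputs ε
  refine ⟨A', hout, ?_⟩
  have h1 := (w.keep S).score_eq_labelScore A E.natLabel fun x y =>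
    Fin.val_inj.trans (E.describes x y)
  have h2 := (w.keep S).labelScore_mergeLabel hη hv' E.natLabel
  have h3 := abs_le.1 (hclose _ ((w.keep S).mergeLabel_le_inv hη hv' E.natLabel))
  have h4 := w.score_eq_labelScore A' _ hA'
  unfold WeightFunction.deficit
  -- The modularity comparison costs `3ε/8`, merging `2ε/8` and transferring the merged score `ε/8`,
  -- in total `6ε/8 < ε`.
  linarith
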